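/- **Setting.** Let $d\ge 1$, $c\ge 2$ and $\widetilde d=d(c-1)$. For a parameter $\theta=(\theta_1,\dots,\theta_{c-1})\in\mathbb R^{\widetilde d}$ consider the multinomial logistic model on $x\in\mathbb R^d$, $$p(y\mid x,\theta)=\frac{e^{\theta_y^\top x}}{1+\sum_{l<c}e^{\theta_l^\top x}}\ (y<c),\qquad p(c\mid x,\theta)=\frac{1}{1+\sum_{l<c}e^{\theta_l^\top x}},$$ with loss $\ell_{(x,y)}(\theta)=-\log p(y\mid x,\theta)$ and Fisher information matrices $\mathbf H(x,\theta)=\mathbb E_{y\sim p(\cdot\mid x,\theta)}[\nabla^2\ell_{(x,y)}(\theta)]$ and $\mathbf H_\mu(\theta)=\mathbb E_{x\sim\mu}[\mathbf H(x,\theta)]$. Write $\langle \mathbf A,\mathbf B\rangle=\operatorname{Tr}(\mathbf A^\top\mathbf B)$. Let $p$ be a probability distribution on $\mathbb R^d$ and $\theta_0\in\mathbb R^{\widetilde d}$ a parameter (for instance the empirical risk minimizer on the initial labelled data) such that the entries of $x\mapsto\mathbf H(x,\theta_0)$ are $p$-integrable. Let $X_0$ be a finite list of $n_0$ initial points and $U=\{x_i\}_{i\in[m]}$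 a finite pool of points in $\mathbb R^d$. For a selection $X$ of $b$ points of $U$ let $q_X$ be the empirical distribution of the $n_0+b$ points $X_0\cup X$, counted with multiplicity. **Optimal selection.** $\widehat X_*$ is a minimizer of $\langle\mathbf H_{q_X}(\theta_0)^{-1},\mathbf H_p(\theta_0)\rangle$ over the size-$b$ selections $X$ from $U$ (the objective is $+\infty$ where $\mathbf H_{q_X}(\theta_0)$ is not positive definite; the minimal value is assumed to be attained at a positive definite matrix), and $\widehat q_*=q_{\widehat X_*}$. **Relaxed problem.** Put $\mathbf H(x_i)=\mathbf H(x_i,\theta_0)+\frac1b\sum_{x\in X_0}\mathbf H(x,\theta_0)$. Let $z_\diamond$ be a minimizer of $\big\langle\big(\sum_i z_i\mathbf H(x_i)\big)^{-1},\mathbf H_p(\theta_0)\big\rangle$ over $z\in\mathbb R^m_{+}$ with $\|z\|_1=b$ and $\sum_i z_i\mathbf H(x_i)$ positive definite; put $\boldsymbol\Sigma_\diamond=\sum_i z_{\diamond,i}\mathbf H(x_i)$ and $\widetilde{\mathbf H}(x_i)=\boldsymbol\Sigma_\diamond^{-1/2}\mathbf H(x_i)\boldsymbol\Sigma_\diamond^{-1/2}$.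 **Rounding algorithm** with learning rate $\eta$. For $t=1,\dots,b$: let $\mathbf A_t^{-1/2}=\nu_t\mathbf I+\eta\sum_{l<t}\widetilde{\mathbf H}(x_{i_l})$, where $\nu_t\in\mathbb R$ is the number for which this matrix is positive definite and $\operatorname{Tr}(\mathbf A_t)=1$; choose $$i_t\in\operatorname*{argmax}_{i\in[m]}\ \operatorname{Tr}\big[\mathbf A_t^{1/2}-(\mathbf A_t^{-1/2}+\eta\widetilde{\mathbf H}(x_i))^{-1}\big],$$ with ties broken arbitrarily. The same index may be chosen more than once. The output is $X=(x_{i_1},\dots,x_{i_b})$; let $q=q_X$. **Corollary.** Let $\epsilon\in(0,1)$, $\eta=8\sqrt{\widetilde d}/\epsilon$ and $b\ge 32\widetilde d/\epsilon^2+16\sqrt{\widetilde d}/\epsilon^2$. Then, for every relaxed solution $z_\diamond$ and every output $X$ of the rounding algorithm, $\mathbf H_q(\theta_0)$ is positive definite and $$\big\langle \mathbf H_q(\theta_0)^{-1},\mathbf H_p(\theta_0)\big\rangle\le(1+\epsilon)\,\big\langle\mathbf H_{\widehat q_*}(\theta_0)^{-1},\mathbf H_p(\theta_0)\big\rangle .$$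 This holds for $\widehat X_*$ optimal among the size-$b$ subsets of $U$, and likewise for $\widehat X_*$ optimal among the size-$b$ selections with repetition allowed. -/

import Mathlib

open MeasureTheory
open scoped Matrix

noncomputable section

namespace FisherSelection

/-- The feature space `ℝ^d`. -/
abbrev Feature (d : ℕ) : Type := EuclideanSpace ℝ (Fin d)

/-- Index set of the parameter vector: one block of length `d` for each of the `c - 1`
non-reference classes, so that there are `d * (c - 1)` coordinates. -/
abbrev ParamIdx (d c : ℕ) : Type := Fin (c - 1) × Fin d

/-- The parameter space `ℝ^(d (c - 1))`. -/
abbrev Param (d c : ℕ) : Type := EuclideanSpace ℝ (ParamIdx d c)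

variable {d c m : ℕ}

/-- The logit `θ_yᵀ x` of class `y`; the last class is the reference class, with logit `0`. -/
def logit (x : Feature d) (θ : Param d c) (y : Fin c) : ℝ :=
  if h : (y : ℕ) < c - 1 then ∑ j : Fin d, θ (⟨y, h⟩, j) * x j else 0

/-- Multinomial logistic regression: the conditional probability `p(y | x, θ)`. -/
def classProb (x : Feature d) (θ : Param d c) (y : Fin c) : ℝ :=
  Real.exp (logit x θ y) / ∑ l : Fin c, Real.exp (logit x θ l)

/-- Negative log-likelihood `ℓ_(x,y)(θ) = - log p(y | x, θ)`. -/
def nll (x : Feature d) (y : Fin c) (θ : Param d c) : ℝ :=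
  -Real.log (classProb x θ y)

/-- The Hessian matrix of a real function of the parameter. -/
def hessian (f : Param d c → ℝ) (θ : Param d c) : Matrix (ParamIdx d c) (ParamIdx d c) ℝ :=
  Matrix.of fun a a' =>
    iteratedFDeriv ℝ 2 f θ ![EuclideanSpace.single a 1, EuclideanSpace.single a' 1]

/-- Fisher information matrix at the point `x`:
`H(x, θ) = E_{y ∼ p(· | x, θ)} [∇²_θ ℓ_(x,y)(θ)]`. -/
def fisher (x : Feature d) (θ : Param d c) : Matrix (ParamIdx d c) (ParamIdx d c) ℝ :=
  ∑ y : Fin c, classProb x θ y • hessian (nll x y) θ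

/-- `H_μ(θ) = E_{x ∼ μ} [H(x, θ)]`, entry by entry. -/
def meanFisher (μ : Measure (Feature d)) (θ : Param d c) :
    Matrix (ParamIdx d c) (ParamIdx d c) ℝ :=
  Matrix.of fun a a' => ∫ x, fisher x θ a a' ∂μ

/-- Empirical distribution `(1 / |s|) ∑_{x ∈ s} δ_x` of a finite list of points
(counted with multiplicity). -/
def empirical (s : Multiset (Feature d)) : Measure (Feature d) :=
  ((Multiset.card s : ℕ) : ENNReal)⁻¹ • (s.map Measure.dirac).sum

/-- The distribution `q` of the points `X₀ ∪ X`, where `X` consists of the pool points with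
indices in `S`. -/
def labelled (X₀ : Multiset (Feature d)) (x : Fin m → Feature d) (S : Multiset (Fin m)) :
    Measure (Feature d) :=
  empirical (X₀ + S.map x)

/-- The Fisher information ratio `⟨A⁻¹, B⟩ = Tr (A⁻¹ B)`; meaningful for positive definite `A`. -/
def fir (A B : Matrix (ParamIdx d c) (ParamIdx d c) ℝ) : ℝ :=
  (A⁻¹ * B).trace

/-- `S` minimizes `⟨H_q(θ₀)⁻¹, H_p(θ₀)⟩` over the selections in the class `C`, the objective being
defined at those selections for which `H_q(θ₀)` is positive definite (and `+∞` at the others). -/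
def IsOptimalSelection (p : Measure (Feature d)) (θ₀ : Param d c) (X₀ : Multiset (Feature d))
    (x : Fin m → Feature d) (C : Set (Multiset (Fin m))) (S : Multiset (Fin m)) : Prop :=
  S ∈ C ∧ (meanFisher (labelled X₀ x S) θ₀).PosDef ∧
    ∀ S' ∈ C, (meanFisher (labelled X₀ x S') θ₀).PosDef →
      fir (meanFisher (labelled X₀ x S) θ₀) (meanFisher p θ₀) ≤
        fir (meanFisher (labelled X₀ x S') θ₀) (meanFisher p θ₀)

/-- The size-`b` subsets of the pool. -/
def subsetsOfSize (m b : ℕ) : Set (Multiset (Fin m)) := {S | S.card = b ∧ S.Nodup}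

/-- The size-`b` selections from the pool in which a point may be repeated. -/
def multisetsOfSize (m b : ℕ) : Set (Multiset (Fin m)) := {S | S.card = b}

/-- `H(x_i) = H(x_i, θ₀) + (1 / b) ∑_{x' ∈ X₀} H(x', θ₀)`. -/
def poolMatrix (θ₀ : Param d c) (X₀ : Multiset (Feature d)) (x : Fin m → Feature d) (b : ℕ)
    (i : Fin m) : Matrix (ParamIdx d c) (ParamIdx d c) ℝ :=
  fisher (x i) θ₀ + (1 / (b : ℝ)) • (X₀.map fun x' => fisher x' θ₀).sum

/-- `Σ(z) = ∑_i z_i H(x_i)`. -/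
def weightedMatrix (θ₀ : Param d c) (X₀ : Multiset (Feature d)) (x : Fin m → Feature d) (b : ℕ)
    (z : Fin m → ℝ) : Matrix (ParamIdx d c) (ParamIdx d c) ℝ :=
  ∑ i, z i • poolMatrix θ₀ X₀ x b i

/-- Feasible points of the relaxed problem: `z ≥ 0`, `‖z‖₁ = b`, in the domain of the objective. -/
def IsRelaxedFeasible (θ₀ : Param d c) (X₀ : Multiset (Feature d)) (x : Fin m → Feature d)
    (b : ℕ) (z : Fin m → ℝ) : Prop :=
  (∀ i, 0 ≤ z i) ∧ ∑ i, z i = (b : ℝ) ∧ (weightedMatrix θ₀ X₀ x b z).PosDef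

/-- `z` solves the relaxed problem: minimize `⟨Σ(z)⁻¹, H_p(θ₀)⟩` over `z ≥ 0`, `‖z‖₁ = b`. -/
def IsRelaxedOptimum (p : Measure (Feature d)) (θ₀ : Param d c) (X₀ : Multiset (Feature d))
    (x : Fin m → Feature d) (b : ℕ) (z : Fin m → ℝ) : Prop :=
  IsRelaxedFeasible θ₀ X₀ x b z ∧ ∀ z', IsRelaxedFeasible θ₀ X₀ x b z' →
    fir (weightedMatrix θ₀ X₀ x b z) (meanFisher p θ₀) ≤
      fir (weightedMatrix θ₀ X₀ x b z') (meanFisher p θ₀)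

open scoped MatrixOrder in
/-- `A^(-1/2)`, the nonnegative square root of `A⁻¹`, for positive definite `A`. -/
def invSqrt (A : Matrix (ParamIdx d c) (ParamIdx d c) ℝ) :
    Matrix (ParamIdx d c) (ParamIdx d c) ℝ :=
  CFC.sqrt A⁻¹

/-- The transformed matrices `H̃(x_i) = Σ(z)^(-1/2) H(x_i) Σ(z)^(-1/2)`. -/
def whitened (θ₀ : Param d c) (X₀ : Multiset (Feature d)) (x : Fin m → Feature d) (b : ℕ)
    (z : Fin m → ℝ) (i : Fin m) : Matrix (ParamIdx d c) (ParamIdx d c) ℝ :=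
  invSqrt (weightedMatrix θ₀ X₀ x b z) * poolMatrix θ₀ X₀ x b i *
    invSqrt (weightedMatrix θ₀ X₀ x b z)

/-- A run of the greedy rounding procedure on the loss matrices `F_1, …, F_m` with learning rate
`η`, selecting the indices `i_1, …, i_b`. In round `t` the player's action `A_t` is given by
`A_t^(-1/2) = ν_t I + η ∑_{l < t} F_{i_l}`, where `ν_t` is the number that makes this matrix
positive definite and `Tr A_t = 1` (so `A_1 = I / dim`), and `i_t` is a maximizer over the whole
pool of `Tr [A_t^(1/2) - (A_t^(-1/2) + η F_j)⁻¹]`; ties are broken arbitrarily. -/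
def IsRoundRun (F : Fin m → Matrix (ParamIdx d c) (ParamIdx d c) ℝ) (η : ℝ) (b : ℕ)
    (i : Fin b → Fin m) : Prop :=
  ∃ M : Fin b → Matrix (ParamIdx d c) (ParamIdx d c) ℝ,
    (∀ t, ∃ ν : ℝ, M t = ν • 1 + η • ∑ l ∈ Finset.Iio t, F (i l)) ∧
    (∀ t, (M t).PosDef) ∧
    (∀ t, ((M t)⁻¹ * (M t)⁻¹).trace = 1) ∧
    ∀ t j, ((M t)⁻¹ - (M t + η • F j)⁻¹).trace ≤ ((M t)⁻¹ - (M t + η • F (i t))⁻¹).trace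

/-- The selection (with multiplicities) made by a run `i_1, …, i_b`. -/
def selected {b : ℕ} (i : Fin b → Fin m) : Multiset (Fin m) :=
  Finset.univ.val.map i

end FisherSelection

end

/-!
After scaling by the number of labelled points, the Fisher matrix of a selection of size `b` is
`∑ j, z j • H(x_j)` at its multiplicities `z` (`meanFisher_labelled`). Every selection is therefore
feasible for the relaxed problem, whose optimal value is at most that of the best selection, and it
suffices to show that rounding loses no more than a factor `1 + ε` against the relaxed optimum `Σ`.
In the coordinates whitened by `Σ^(-1/2)` the loss matrices `F_j` satisfy `∑ j, z j • F_j = 1`, and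
a lower bound `τ ≥ 1 / (1 + ε)` on the least eigenvalue of `S = ∑ t, F (i t)` is enough
(`posDef_and_fir_le_of_whitened`).

Such a bound comes from follow-the-regularized-leader with the regularizer `-2 Tr A^(1/2)`, whose
dual potential is `Φ(S) = min_ν (ν + Tr (ν + η S)⁻¹)`. The number `ν_t` of the algorithm is the
minimizer, as `Tr A_t = 1` is the condition that the derivative vanishes. With `n = d (c - 1)`:

* the potential starts at `2 √n`;
* the greedy gain `Tr [M_t⁻¹ - (M_t + η F_j)⁻¹]` lowers it in every round
  (`trace_inv_le_trace_inv_add`);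
* the gain of `F_j` is at least `η Tr (M_t⁻² F_j) / (1 + η Tr (M_t⁻¹ F_j))` (`trace_mul_le_gain`),
  so averaging over `j` with the weights `z` gives some `j` of gain at least `η / (b + η √n)`
  (`le_max_gain`);
* the final value is at least `2 - η λ_min(S)` (`posSemidef_sub_smul_one_of_dual`).

Together, `λ_min(S) ≥ (2 - 2 √n) / η + b / (b + η √n)` (`posSemidef_sum_sub_smul_one`), which for
the given `η` and `b` is at least `1 / (1 + ε)` (`one_le_one_add_mul_of_budget`).

The Fisher matrices are positive semidefinite because each loss is log-sum-exp of linear forms minus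
a linear form, and the second derivative of log-sum-exp along a line is a variance
(`deriv_deriv_log_sum_exp_nonneg`).
-/

namespace FisherSelection

/-! ### Inequalities between positive semidefinite matrices -/


section MatrixInequalities

variable {n : Type*} [Fintype n]

open scoped MatrixOrder in
lemma exists_eq_conjTranspose_mul_self {A : Matrix n n ℝ} (hA : A.PosSemidef) :
    ∃ C : Matrix n n ℝ, A = Cᴴ * C := by
  classical
  exact CStarAlgebra.nonneg_iff_eq_star_mul_self.mp (Matrix.nonneg_iff_posSemidef.mpr hA)

lemma trace_mul_nonneg_of_posSemidef {A B : Matrix n n ℝ} (hA : A.PosSemidef)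
    (hB : B.PosSemidef) : 0 ≤ (A * B).trace := by
  obtain ⟨C, rfl⟩ := exists_eq_conjTranspose_mul_self hB
  rw [← mul_assoc, Matrix.trace_mul_comm, ← mul_assoc]
  exact (hA.mul_mul_conjTranspose_same C).trace_nonneg

lemma trace_mul_self_nonneg_of_isHermitian {A : Matrix n n ℝ} (hA : A.IsHermitian) :
    0 ≤ (A * A).trace := by
  have h := (Matrix.posSemidef_conjTranspose_mul_self A).trace_nonneg
  rwa [hA.eq] at h

lemma posSemidef_conj_of_isHermitian {A B : Matrix n n ℝ} (hA : A.PosSemidef)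
    (hB : B.IsHermitian) : (B * A * B).PosSemidef := by
  have h := hA.conjTranspose_mul_mul_same B
  rwa [hB.eq] at h

variable [DecidableEq n]

/-- The Cauchy–Schwarz inequality for the pair of dual norms given by `M⁻¹` and `M`. -/
lemma sq_dotProduct_le_of_posDef {M : Matrix n n ℝ} (hM : M.PosDef) (u v : n → ℝ) :
    (u ⬝ᵥ v) ^ 2 ≤ (u ⬝ᵥ (M⁻¹ *ᵥ u)) * (v ⬝ᵥ (M *ᵥ v)) := by
  have hdet : IsUnit M.det := (Matrix.isUnit_iff_isUnit_det M).mp hM.isUnit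
  have hsymm : Mᵀ = M := by
    rw [← Matrix.conjTranspose_eq_transpose_of_trivial]; exact hM.isHermitian.eq
  have h : ∀ t : ℝ, 0 ≤ (v ⬝ᵥ (M *ᵥ v)) * (t * t) + (2 * (u ⬝ᵥ v)) * t
      + u ⬝ᵥ (M⁻¹ *ᵥ u) := by
    intro t
    have h0 := hM.posSemidef.dotProduct_mulVec_nonneg (M⁻¹ *ᵥ u + t • v)
    have h1 : M *ᵥ (M⁻¹ *ᵥ u) = u := by
      rw [Matrix.mulVec_mulVec, Matrix.mul_nonsing_inv _ hdet, Matrix.one_mulVec]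
    have h2 : (M⁻¹ *ᵥ u) ⬝ᵥ (M *ᵥ v) = u ⬝ᵥ v := by
      rw [Matrix.dotProduct_mulVec, ← Matrix.mulVec_transpose, hsymm, h1]
    simp only [star_trivial, Matrix.mulVec_add, Matrix.mulVec_smul, h1, add_dotProduct,
      dotProduct_add, smul_dotProduct, dotProduct_smul, h2, smul_eq_mul] at h0
    rw [dotProduct_comm v u, dotProduct_comm (M⁻¹ *ᵥ u) u] at h0
    linarith
  have := discrim_le_zero h
  rw [discrim] at this
  linarith

/-- In the Loewner order, `F ≤ Tr (M⁻¹ F) M`: factor `F = Cᴴ C` and apply the Cauchy–Schwarz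
inequality to each row of `C`. -/
lemma posSemidef_trace_smul_sub {M F : Matrix n n ℝ} (hM : M.PosDef) (hF : F.PosSemidef) :
    ((M⁻¹ * F).trace • M - F).PosSemidef := by
  refine .of_dotProduct_mulVec_nonneg
    ((hM.isHermitian.smul (star_trivial _)).sub hF.isHermitian) fun v => ?_
  obtain ⟨C, rfl⟩ := exists_eq_conjTranspose_mul_self hF
  rw [Matrix.sub_mulVec, Matrix.smul_mulVec, star_trivial, dotProduct_sub, dotProduct_smul,
    sub_nonneg, smul_eq_mul]
  have h1 : v ⬝ᵥ ((Cᴴ * C) *ᵥ v) = ∑ k, (C k ⬝ᵥ v) ^ 2 := by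
    rw [← Matrix.mulVec_mulVec, Matrix.dotProduct_mulVec,
      Matrix.conjTranspose_eq_transpose_of_trivial, Matrix.vecMul_transpose]
    simp only [dotProduct, Matrix.mulVec, sq]
  have h2 : (M⁻¹ * (Cᴴ * C)).trace = ∑ k, C k ⬝ᵥ (M⁻¹ *ᵥ C k) := by
    rw [← mul_assoc, Matrix.trace_mul_comm, Matrix.conjTranspose_eq_transpose_of_trivial]
    simp only [Matrix.trace, Matrix.diag, Matrix.mul_apply, dotProduct, Matrix.mulVec,
      Matrix.transpose_apply]
  rw [h1, h2, Finset.sum_mul]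
  exact Finset.sum_le_sum fun k _ => sq_dotProduct_le_of_posDef hM (C k) v

lemma dotProduct_mulVec_le_trace {F : Matrix n n ℝ} (hF : F.PosSemidef) (v : n → ℝ) :
    v ⬝ᵥ (F *ᵥ v) ≤ F.trace * (v ⬝ᵥ v) := by
  have h := (posSemidef_trace_smul_sub Matrix.PosDef.one hF).dotProduct_mulVec_nonneg v
  simpa [Matrix.sub_mulVec, Matrix.smul_mulVec, dotProduct_sub] using h

/-- If `0 ≤ E ≤ s N` then `E N⁻¹ E ≤ s E`, by the identity
`s (s E - E N⁻¹ E) = (s - E N⁻¹) E (s - N⁻¹ E) + E N⁻¹ (s N - E) N⁻¹ E`. -/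
lemma posSemidef_smul_sub_mul_inv_mul {N E : Matrix n n ℝ} {s : ℝ} (hs : 0 < s)
    (hN : N.PosDef) (hE : E.PosSemidef) (h : (s • N - E).PosSemidef) :
    (s • E - E * N⁻¹ * E).PosSemidef := by
  have hdet : IsUnit N.det := (Matrix.isUnit_iff_isUnit_det N).mp hN.isUnit
  have hNi : (N⁻¹)ᴴ = N⁻¹ := hN.inv.isHermitian.eq
  have h1 := hE.conjTranspose_mul_mul_same (s • (1 : Matrix n n ℝ) - N⁻¹ * E)
  have h2 := h.conjTranspose_mul_mul_same (N⁻¹ * E)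
  have key : s • E - E * N⁻¹ * E =
      s⁻¹ • ((s • (1 : Matrix n n ℝ) - N⁻¹ * E)ᴴ * E * (s • (1 : Matrix n n ℝ) - N⁻¹ * E) +
        (N⁻¹ * E)ᴴ * (s • N - E) * (N⁻¹ * E)) := by
    have hc : E * N⁻¹ * N * (N⁻¹ * E) = E * N⁻¹ * E := by
      rw [Matrix.nonsing_inv_mul_cancel_right _ _ hdet, mul_assoc]
    rw [eq_inv_smul_iff₀ hs.ne']
    simp only [Matrix.conjTranspose_sub, Matrix.conjTranspose_smul, Matrix.conjTranspose_one,
      Matrix.conjTranspose_mul, hNi, hE.isHermitian.eq, star_trivial, sub_mul, mul_sub,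
      smul_mul_assoc, mul_smul_comm, hc, one_mul, mul_one, smul_sub]
    simp only [mul_assoc]
    abel
  rw [key]
  exact (h1.add h2).smul (inv_nonneg.mpr hs.le)

/-- The one-round gain `Tr [M⁻¹ - (M + η F)⁻¹]` is at least
`η Tr (M⁻² F) / (1 + η Tr (M⁻¹ F))`. -/
lemma trace_mul_le_gain {M F : Matrix n n ℝ} {η : ℝ} (hη : 0 ≤ η) (hM : M.PosDef)
    (hF : F.PosSemidef) :
    η * (M⁻¹ * F * M⁻¹).trace ≤
      (1 + η * (M⁻¹ * F).trace) * (M⁻¹ - (M + η • F)⁻¹).trace := by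
  obtain ⟨E, hE⟩ : ∃ E, E = η • F := ⟨_, rfl⟩
  have hEp : E.PosSemidef := hE ▸ hF.smul hη
  have e1 : η * (M⁻¹ * F * M⁻¹).trace = (M⁻¹ * E * M⁻¹).trace := by
    simp [hE, Matrix.trace_smul]
  have e2 : η * (M⁻¹ * F).trace = (M⁻¹ * E).trace := by simp [hE, Matrix.trace_smul]
  rw [e1, e2, ← hE]
  clear e1 e2 hE
  have hN : (M + E).PosDef := hM.add_posSemidef hEp
  have hdM : IsUnit M.det := (Matrix.isUnit_iff_isUnit_det M).mp hM.isUnit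
  have hdN : IsUnit (M + E).det := (Matrix.isUnit_iff_isUnit_det _).mp hN.isUnit
  have hle := posSemidef_trace_smul_sub hM hEp
  have hτ : 0 ≤ (M⁻¹ * E).trace := trace_mul_nonneg_of_posSemidef hM.inv.posSemidef hEp
  obtain hτ0 | hτ0 := hτ.eq_or_lt
  · have hE0 : E = 0 := by
      rw [← hτ0, zero_smul, zero_sub] at hle
      have := hle.trace_nonneg
      rw [Matrix.trace_neg] at this
      exact hEp.trace_eq_zero_iff.mp (le_antisymm (by linarith) hEp.trace_nonneg)
    simp [hE0]
  · set τ := (M⁻¹ * E).trace with hτdef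
    have hτ1 : (0 : ℝ) < 1 + τ := by linarith
    have hsN : ((τ / (1 + τ)) • (M + E) - E).PosSemidef := by
      have : (τ / (1 + τ)) • (M + E) - E = (1 + τ)⁻¹ • (τ • M - E) := by
        ext i j
        simp only [Matrix.sub_apply, Matrix.smul_apply, Matrix.add_apply, smul_eq_mul]
        field_simp
        ring
      rw [this]
      exact hle.smul (inv_nonneg.mpr hτ1.le)
    have h4 := posSemidef_conj_of_isHermitian
      (posSemidef_smul_sub_mul_inv_mul (div_pos hτ0 hτ1) hN hEp hsN) hM.inv.isHermitian
    have hdiff : M⁻¹ - (M + E)⁻¹ = M⁻¹ * (E - E * (M + E)⁻¹ * E) * M⁻¹ := by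
      have a1 : E - E * (M + E)⁻¹ * E = E * (M + E)⁻¹ * M := by
        have : E * (M + E)⁻¹ * (M + E) = E := Matrix.nonsing_inv_mul_cancel_right _ _ hdN
        rw [mul_add] at this
        rw [sub_eq_iff_eq_add]; exact this.symm
      have a2 : M⁻¹ * (M + E) * (M + E)⁻¹ = M⁻¹ := Matrix.mul_nonsing_inv_cancel_right _ _ hdN
      rw [mul_add, add_mul, Matrix.nonsing_inv_mul _ hdM, one_mul] at a2
      rw [a1, ← mul_assoc, Matrix.mul_nonsing_inv_cancel_right _ _ hdM, ← mul_assoc]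
      rw [sub_eq_iff_eq_add, add_comm]; exact a2.symm
    have h5 := h4.trace_nonneg
    rw [hdiff]
    simp only [mul_sub, sub_mul, Matrix.trace_sub, mul_smul_comm, smul_mul_assoc,
      Matrix.trace_smul, smul_eq_mul] at h5 ⊢
    have h6 := mul_nonneg hτ1.le h5
    have h7 : (1 + τ) * (τ / (1 + τ)) = τ := by field_simp
    rw [mul_sub, ← mul_assoc, h7] at h6
    linarith

/-- Convexity of `ν ↦ ν + Tr (ν + S)⁻¹` at a point `P = ν + S` where its derivative
`1 - Tr P⁻²` vanishes. -/
lemma trace_inv_le_trace_inv_add {P N : Matrix n n ℝ} {δ : ℝ} (hP : P.PosDef) (hN : N.PosDef)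
    (hNP : N = P + δ • 1) (h1 : (P⁻¹ * P⁻¹).trace = 1) :
    P⁻¹.trace ≤ N⁻¹.trace + δ := by
  have hdP : IsUnit P.det := (Matrix.isUnit_iff_isUnit_det P).mp hP.isUnit
  have hdN : IsUnit N.det := (Matrix.isUnit_iff_isUnit_det N).mp hN.isUnit
  have a1 : N⁻¹ = P⁻¹ - δ • (P⁻¹ * N⁻¹) := by
    have : P⁻¹ * N * N⁻¹ = P⁻¹ := Matrix.mul_nonsing_inv_cancel_right _ _ hdN
    nth_rw 1 [hNP] at this
    rw [mul_add, add_mul, Matrix.nonsing_inv_mul _ hdP, one_mul, mul_smul_comm, mul_one,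
      smul_mul_assoc] at this
    rw [eq_sub_iff_add_eq]; exact this
  have a2 : N⁻¹ = P⁻¹ - δ • (N⁻¹ * P⁻¹) := by
    have : N⁻¹ * (N * P⁻¹) = P⁻¹ := by
      rw [← mul_assoc, Matrix.nonsing_inv_mul _ hdN, one_mul]
    nth_rw 2 [hNP] at this
    rw [add_mul, mul_add, Matrix.mul_nonsing_inv _ hdP, mul_one, smul_mul_assoc, one_mul,
      mul_smul_comm] at this
    rw [eq_sub_iff_add_eq]; exact this
  have a3 : N⁻¹ = P⁻¹ - δ • (P⁻¹ * P⁻¹) + δ ^ 2 • (P⁻¹ * N⁻¹ * P⁻¹) := by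
    conv_lhs => rw [a1, a2]
    rw [mul_sub, mul_smul_comm, smul_sub, smul_smul, sq, ← mul_assoc]
    abel
  have a4 := (posSemidef_conj_of_isHermitian hN.inv.posSemidef hP.inv.isHermitian).trace_nonneg
  have a5 := congrArg Matrix.trace a3
  simp only [Matrix.trace_add, Matrix.trace_sub, Matrix.trace_smul, smul_eq_mul, h1] at a5
  nlinarith [mul_nonneg (sq_nonneg δ) a4]

/-- The value `ν + Tr (ν + η S)⁻¹` of the dual objective bounds the least eigenvalue of `S` from
below, since `ν + 1 / (ν + η s) ≥ 2 - η s` for every Rayleigh quotient `s` of `S`. -/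
lemma posSemidef_sub_smul_one_of_dual {S : Matrix n n ℝ} {ν η τ : ℝ} (hη : 0 < η)
    (hS : S.IsHermitian) (hN : (ν • (1 : Matrix n n ℝ) + η • S).PosDef)
    (hτ : η * τ + ν + (ν • (1 : Matrix n n ℝ) + η • S)⁻¹.trace ≤ 2) :
    (S - τ • (1 : Matrix n n ℝ)).PosSemidef := by
  refine .of_dotProduct_mulVec_nonneg
    (hS.sub (Matrix.isHermitian_one.smul (star_trivial _))) fun v => ?_
  rw [star_trivial]
  by_cases hv : v = 0
  · simp [hv]
  set N := ν • (1 : Matrix n n ℝ) + η • S with hNdef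
  have hw : 0 < v ⬝ᵥ (N *ᵥ v) := by simpa using hN.dotProduct_mulVec_pos hv
  have hn : 0 < v ⬝ᵥ v := by
    simpa using (Matrix.PosDef.one (n := n) (R := ℝ)).dotProduct_mulVec_pos hv
  have hwe : v ⬝ᵥ (N *ᵥ v) = ν * (v ⬝ᵥ v) + η * (v ⬝ᵥ (S *ᵥ v)) := by
    simp [hNdef, Matrix.add_mulVec, Matrix.smul_mulVec, dotProduct_add]
  have hcs := sq_dotProduct_le_of_posDef hN v v
  have htr := dotProduct_mulVec_le_trace hN.inv.posSemidef v
  simp only [Matrix.sub_mulVec, Matrix.smul_mulVec, Matrix.one_mulVec, dotProduct_sub,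
    dotProduct_smul, smul_eq_mul, sub_nonneg]
  set w := v ⬝ᵥ (N *ᵥ v)
  set k := v ⬝ᵥ v
  set s := v ⬝ᵥ (S *ᵥ v)
  set T := N⁻¹.trace
  have h1 : k ≤ T * w := by
    have h2 : k * k ≤ T * w * k := by
      calc k * k = k ^ 2 := (sq k).symm
        _ ≤ _ := hcs
        _ ≤ (T * k) * w := mul_le_mul_of_nonneg_right htr hw.le
        _ = _ := by ring
    exact le_of_mul_le_mul_right h2 hn
  -- `(w - k)² ≥ 0` is the inequality `w / k + k / w ≥ 2`.
  have h3 : 2 * k ≤ w + T * k := by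
    have : 2 * k * w ≤ (w + T * k) * w := by nlinarith [sq_nonneg (w - k)]
    exact le_of_mul_le_mul_right this hw
  have h4 : η * (τ * k) ≤ η * s := by nlinarith
  exact le_of_mul_le_mul_left h4 hη

/-- The inequality `Tr (1 - √n B)² ≥ 0`, rearranged. -/
lemma trace_le_sqrt_card {B : Matrix n n ℝ} [Nonempty n] (hB : B.IsHermitian)
    (h1 : (B * B).trace = 1) : B.trace ≤ √(Fintype.card n : ℝ) := by
  have hD : (0 : ℝ) < Fintype.card n := by exact_mod_cast Fintype.card_pos
  set r := √(Fintype.card n : ℝ) with hr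
  have hr0 : 0 < r := Real.sqrt_pos.mpr hD
  have hrr : r * r = Fintype.card n := Real.mul_self_sqrt hD.le
  have h := trace_mul_self_nonneg_of_isHermitian
    ((Matrix.isHermitian_one (n := n) (α := ℝ)).sub (hB.smul (star_trivial r)))
  simp only [sub_mul, mul_sub, one_mul, mul_one, smul_mul_assoc, mul_smul_comm, Matrix.trace_sub,
    Matrix.trace_smul, Matrix.trace_one, smul_eq_mul, h1] at h
  have : r * B.trace ≤ r * r := by nlinarith
  exact le_of_mul_le_mul_left this hr0

/-- The bound `τ S⁻¹ ≤ 1` following from `τ ≤ S`, tested against a positive semidefinite `K`. -/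
lemma smul_trace_inv_mul_le {S K : Matrix n n ℝ} {τ : ℝ} (hτ : 0 ≤ τ) (hS : S.PosDef)
    (h : (S - τ • (1 : Matrix n n ℝ)).PosSemidef) (hK : K.PosSemidef) :
    τ * (S⁻¹ * K).trace ≤ K.trace := by
  have hd : IsUnit S.det := (Matrix.isUnit_iff_isUnit_det S).mp hS.isUnit
  -- `S² - τ S = (S - τ)² + τ (S - τ)`
  have h1 : ((S - τ • (1 : Matrix n n ℝ)) ^ 2 + τ • (S - τ • (1 : Matrix n n ℝ))).PosSemidef :=
    (h.pow 2).add (h.smul hτ)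
  have h2 := posSemidef_conj_of_isHermitian h1 hS.inv.isHermitian
  have h3 : S⁻¹ * ((S - τ • (1 : Matrix n n ℝ)) ^ 2 + τ • (S - τ • (1 : Matrix n n ℝ))) * S⁻¹
      = 1 - τ • S⁻¹ := by
    have : (S - τ • (1 : Matrix n n ℝ)) ^ 2 + τ • (S - τ • (1 : Matrix n n ℝ))
        = S * (S - τ • (1 : Matrix n n ℝ)) := by
      simp only [sq, sub_mul, mul_sub, smul_mul_assoc, mul_smul_comm, one_mul, mul_one, smul_sub]
      abel
    rw [this, ← mul_assoc, Matrix.nonsing_inv_mul _ hd, one_mul, sub_mul,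
      Matrix.mul_nonsing_inv _ hd, smul_mul_assoc, one_mul]
  rw [h3] at h2
  have h4 := trace_mul_nonneg_of_posSemidef h2 hK
  simp only [sub_mul, one_mul, smul_mul_assoc, Matrix.trace_sub, Matrix.trace_smul,
    smul_eq_mul] at h4
  linarith

end MatrixInequalities


/-! ### Spectral bound for greedy rounding -/


section Rounding

variable {n : Type*} [Fintype n] [DecidableEq n] {m b : ℕ}

/-- Some loss matrix has gain at least `η / (b + η √n)`: average `trace_mul_le_gain` with the
weights `z`, which turn `Tr (M⁻² F_j)` into `Tr M⁻² = 1` and `Tr (M⁻¹ F_j)` into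
`Tr M⁻¹ ≤ √n`. -/
lemma le_max_gain [Nonempty n] {F : Fin m → Matrix n n ℝ} {z : Fin m → ℝ} {η : ℝ}
    {M : Matrix n n ℝ} {Δ : ℝ} (hF : ∀ j, (F j).PosSemidef) (hz : ∀ j, 0 ≤ z j)
    (hzb : ∑ j, z j = (b : ℝ)) (hzF : ∑ j, z j • F j = 1) (hη : 0 < η) (hM : M.PosDef)
    (hM1 : (M⁻¹ * M⁻¹).trace = 1)
    (hΔ : ∀ j, (M⁻¹ - (M + η • F j)⁻¹).trace ≤ Δ) :
    η / (b + η * √(Fintype.card n : ℝ)) ≤ Δ := by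
  have h1 : ∀ j, η * (z j * (M⁻¹ * F j * M⁻¹).trace) ≤
      (z j + η * (z j * (M⁻¹ * F j).trace)) * Δ := by
    intro j
    have hc : 0 ≤ 1 + η * (M⁻¹ * F j).trace := by
      have := trace_mul_nonneg_of_posSemidef hM.inv.posSemidef (hF j)
      positivity
    have h := mul_le_mul_of_nonneg_left ((trace_mul_le_gain hη.le hM (hF j)).trans
      (mul_le_mul_of_nonneg_left (hΔ j) hc)) (hz j)
    linarith
  have h2 := Finset.sum_le_sum fun j (_ : j ∈ Finset.univ) => h1 j
  have e1 : ∑ j, z j * (M⁻¹ * F j * M⁻¹).trace = 1 := by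
    have : ∑ j, z j * (M⁻¹ * F j * M⁻¹).trace = (M⁻¹ * (∑ j, z j • F j) * M⁻¹).trace := by
      simp [Finset.mul_sum, Finset.sum_mul, Matrix.trace_sum]
    rw [this, hzF, mul_one, hM1]
  have e2 : ∑ j, z j * (M⁻¹ * F j).trace = M⁻¹.trace := by
    have : ∑ j, z j * (M⁻¹ * F j).trace = (M⁻¹ * (∑ j, z j • F j)).trace := by
      simp [Finset.mul_sum, Matrix.trace_sum]
    rw [this, hzF, mul_one]
  rw [← Finset.mul_sum, ← Finset.sum_mul, Finset.sum_add_distrib, ← Finset.mul_sum, e1, e2, hzb,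
    mul_one] at h2
  have hT0 : 0 ≤ M⁻¹.trace := hM.inv.posSemidef.trace_nonneg
  have hTr := trace_le_sqrt_card hM.inv.isHermitian hM1
  have hr : 0 < √(Fintype.card n : ℝ) :=
    Real.sqrt_pos.mpr (by exact_mod_cast Fintype.card_pos)
  have hb : (0 : ℝ) ≤ b := Nat.cast_nonneg b
  have hΔ0 : 0 ≤ Δ := by
    by_contra hneg
    have : 0 ≤ (b : ℝ) + η * M⁻¹.trace := by positivity
    nlinarith
  rw [div_le_iff₀ (by positivity)]
  calc η ≤ (b + η * M⁻¹.trace) * Δ := h2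
    _ ≤ (b + η * √(Fintype.card n : ℝ)) * Δ := by gcongr
    _ = _ := mul_comm _ _

/-- The dual potential `ν_t + Tr M_t⁻¹` starts at `2 √n` and each greedy round lowers it by at
least `η / (b + η √n)`; its final value bounds the least eigenvalue of the selected sum. -/
theorem posSemidef_sum_sub_smul_one [Nonempty n] {F : Fin m → Matrix n n ℝ} {z : Fin m → ℝ}
    {η : ℝ} (hF : ∀ j, (F j).PosSemidef) (hz : ∀ j, 0 ≤ z j)
    (hzb : ∑ j, z j = (b : ℝ)) (hzF : ∑ j, z j • F j = 1) (hη : 0 < η) (hb : 0 < b)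
    {i : Fin b → Fin m} {M : Fin b → Matrix n n ℝ} {ν : Fin b → ℝ}
    (hMν : ∀ t, M t = ν t • (1 : Matrix n n ℝ) + η • ∑ l ∈ Finset.Iio t, F (i l))
    (hM : ∀ t, (M t).PosDef) (hM1 : ∀ t, ((M t)⁻¹ * (M t)⁻¹).trace = 1)
    (hmax : ∀ t j, ((M t)⁻¹ - (M t + η • F j)⁻¹).trace ≤
      ((M t)⁻¹ - (M t + η • F (i t))⁻¹).trace) :
    ((∑ t, F (i t)) - ((2 - 2 * √(Fintype.card n : ℝ)) / η +
      b / (b + η * √(Fintype.card n : ℝ))) • (1 : Matrix n n ℝ)).PosSemidef := by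
  set r := √(Fintype.card n : ℝ) with hr
  have hD : (0 : ℝ) < Fintype.card n := by exact_mod_cast Fintype.card_pos
  have hr0 : 0 < r := Real.sqrt_pos.mpr hD
  have hrr : r * r = Fintype.card n := Real.mul_self_sqrt hD.le
  have hb0 : (0 : ℝ) < b := by exact_mod_cast hb
  have hstep : ∀ t, ν t + (M t + η • F (i t))⁻¹.trace ≤
      ν t + (M t)⁻¹.trace - η / (b + η * r) := by
    intro t
    have h := le_max_gain hF hz hzb hzF hη (hM t) (hM1 t) (hmax t)
    rw [Matrix.trace_sub] at h
    linarith
  have hpot : ∀ (k : ℕ) (hk : k < b), ν ⟨k, hk⟩ + (M ⟨k, hk⟩)⁻¹.trace ≤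
      2 * r - k * (η / (b + η * r)) := by
    intro k
    induction k with
    | zero =>
      intro hk
      have h0 : M ⟨0, hk⟩ = ν ⟨0, hk⟩ • (1 : Matrix n n ℝ) := by
        have : Finset.Iio (⟨0, hk⟩ : Fin b) = ∅ := by
          ext l; simp [Fin.lt_def]
        rw [hMν, this]; simp
      have hν : 0 < ν ⟨0, hk⟩ := by
        have := (hM ⟨0, hk⟩).diag_pos (i := Classical.arbitrary n)
        simpa [h0] using this
      have hinv : (M ⟨0, hk⟩)⁻¹ = (ν ⟨0, hk⟩)⁻¹ • (1 : Matrix n n ℝ) := by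
        apply Matrix.inv_eq_left_inv
        rw [h0, smul_mul_smul_comm, inv_mul_cancel₀ hν.ne', one_mul, one_smul]
      have h1 := hM1 ⟨0, hk⟩
      have hT := trace_le_sqrt_card (hM ⟨0, hk⟩).inv.isHermitian (hM1 ⟨0, hk⟩)
      rw [hinv, smul_mul_smul_comm, one_mul, Matrix.trace_smul, Matrix.trace_one, smul_eq_mul,
        ← hrr] at h1
      have hνr : ν ⟨0, hk⟩ * ν ⟨0, hk⟩ = r * r := by
        field_simp at h1
        linarith
      have : ν ⟨0, hk⟩ = r := by nlinarith
      rw [Nat.cast_zero, zero_mul, sub_zero]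
      linarith
    | succ k ih =>
      intro hk
      have hk' : k < b := by omega
      have hIio : Finset.Iio (⟨k + 1, hk⟩ : Fin b) =
          insert (⟨k, hk'⟩ : Fin b) (Finset.Iio ⟨k, hk'⟩) := by
        ext l
        simp only [Finset.mem_Iio, Finset.mem_insert, Fin.lt_def, Fin.ext_iff]
        omega
      have hN : M ⟨k, hk'⟩ + η • F (i ⟨k, hk'⟩) =
          M ⟨k + 1, hk⟩ + (ν ⟨k, hk'⟩ - ν ⟨k + 1, hk⟩) • (1 : Matrix n n ℝ) := by
        rw [hMν ⟨k + 1, hk⟩, hIio, Finset.sum_insert (by simp), hMν ⟨k, hk'⟩, smul_add, sub_smul]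
        abel
      have h := trace_inv_le_trace_inv_add (hM ⟨k + 1, hk⟩)
        ((hM ⟨k, hk'⟩).add_posSemidef ((hF (i ⟨k, hk'⟩)).smul hη.le)) hN (hM1 _)
      have h2 := hstep ⟨k, hk'⟩
      have h3 := ih hk'
      push_cast
      linarith
  obtain ⟨k, rfl⟩ : ∃ k, b = k + 1 := ⟨b - 1, by omega⟩
  have hlast : ν (Fin.last k) • (1 : Matrix n n ℝ) + η • ∑ t, F (i t) =
      M (Fin.last k) + η • F (i (Fin.last k)) := by
    have : (Finset.univ : Finset (Fin (k + 1))) =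
        insert (Fin.last k) (Finset.Iio (Fin.last k)) := by
      ext l
      simp only [Finset.mem_univ, Finset.mem_Iio, Finset.mem_insert, Fin.lt_def, Fin.ext_iff,
        Fin.val_last, true_iff]
      omega
    rw [this, Finset.sum_insert (by simp), hMν, smul_add]
    abel
  refine posSemidef_sub_smul_one_of_dual (ν := ν (Fin.last k)) hη
    (Matrix.posSemidef_sum _ fun t _ => hF (i t)).isHermitian ?_ ?_
  · rw [hlast]
    exact (hM _).add_posSemidef ((hF _).smul hη.le)
  · rw [hlast]
    have h1 := hstep (Fin.last k)
    have h2 : ν (Fin.last k) + (M (Fin.last k))⁻¹.trace ≤ _ := hpot k (Nat.lt_succ_self k)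
    have h3 : η * ((2 - 2 * r) / η + ((k + 1 : ℕ) : ℝ) / (((k + 1 : ℕ) : ℝ) + η * r)) =
        2 - 2 * r + (k + 1 : ℝ) * (η / (((k + 1 : ℕ) : ℝ) + η * r)) := by
      push_cast
      field_simp
    rw [h3]
    linarith

/-- With `η = 8 r / ε` and `b ≥ 32 r² / ε²` both error terms `2 r / η` and `η r / b` are at most
`ε / 4`, so that the eigenvalue bound is at least `1 - ε / 2 ≥ 1 / (1 + ε)`. -/
lemma one_le_one_add_mul_of_budget {r ε η b : ℝ} (hr : 0 < r) (hε₀ : 0 < ε) (hε₁ : ε < 1)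
    (hη : η = 8 * r / ε) (hb : 32 * r ^ 2 / ε ^ 2 ≤ b) :
    1 ≤ (1 + ε) * ((2 - 2 * r) / η + b / (b + η * r)) := by
  have hη0 : 0 < η := hη ▸ by positivity
  have hb0 : 0 < b := lt_of_lt_of_le (by positivity) hb
  have h1 : -(ε / 4) ≤ (2 - 2 * r) / η := by
    have : 2 * r / η = ε / 4 := by rw [hη]; field_simp; norm_num
    rw [sub_div, this]
    have : 0 < 2 / η := by positivity
    linarith
  have h2 : 1 - ε / 4 ≤ b / (b + η * r) := by
    rw [le_div_iff₀ (by positivity)]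
    have h3 : η * r ≤ ε / 4 * b := by
      calc η * r = ε / 4 * (32 * r ^ 2 / ε ^ 2) := by rw [hη]; field_simp; norm_num
        _ ≤ _ := by gcongr
    have : 0 ≤ ε / 4 * (η * r) := by positivity
    nlinarith
  nlinarith

end Rounding


/-! ### Fisher information of multinomial logistic regression -/


section FisherMatrix

variable {d c m : ℕ}

/-- The logit of a fixed class at a fixed point, as a continuous linear form in the parameter. -/
noncomputable def logitCLM (x : Feature d) (y : Fin c) : Param d c →L[ℝ] ℝ :=
  if h : (y : ℕ) < c - 1 then ∑ j : Fin d, x j • EuclideanSpace.proj (⟨y, h⟩, j) else 0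

lemma logitCLM_apply (x : Feature d) (y : Fin c) (θ : Param d c) :
    logitCLM x y θ = logit x θ y := by
  unfold logitCLM logit
  split_ifs with h
  · simp [mul_comm]
  · simp

lemma sum_exp_logit_pos [NeZero c] (x : Feature d) (θ : Param d c) :
    0 < ∑ l : Fin c, Real.exp (logitCLM x l θ) :=
  Finset.sum_pos (fun _ _ => Real.exp_pos _) Finset.univ_nonempty

lemma nll_eq [NeZero c] (x : Feature d) (y : Fin c) :
    nll x y = fun θ => Real.log (∑ l : Fin c, Real.exp (logitCLM x l θ)) - logitCLM x y θ := by
  funext θ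
  have h := sum_exp_logit_pos x θ
  simp only [logitCLM_apply] at h ⊢
  rw [nll, classProb, Real.log_div (Real.exp_pos _).ne' h.ne', Real.log_exp]
  ring

lemma contDiff_nll [NeZero c] (x : Feature d) (y : Fin c) : ContDiff ℝ 2 (nll x y) := by
  rw [nll_eq]
  exact (ContDiff.log (ContDiff.sum fun l _ => (logitCLM x l).contDiff.exp)
    fun θ => (sum_exp_logit_pos x θ).ne').sub (logitCLM x y).contDiff

/-- The second derivative of log-sum-exp along a line is a variance, by the Cauchy–Schwarz
inequality. -/
lemma deriv_deriv_log_sum_exp_nonneg {ι : Type*} [Fintype ι] [Nonempty ι] (a s : ι → ℝ) (u : ℝ) :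
    0 ≤ deriv (deriv fun t : ℝ =>
      Real.log (∑ l, Real.exp (a l + t * s l)) - (u * t)) 0 := by
  have hpos : ∀ t : ℝ, 0 < ∑ l, Real.exp (a l + t * s l) := fun t =>
    Finset.sum_pos (fun _ _ => Real.exp_pos _) Finset.univ_nonempty
  have hexp : ∀ (l : ι) (t : ℝ), HasDerivAt (fun t => Real.exp (a l + t * s l))
      (Real.exp (a l + t * s l) * s l) t := fun l t => by
    simpa using (((hasDerivAt_id t).mul_const (s l)).const_add (a l)).exp
  have hZ : ∀ t : ℝ, HasDerivAt (fun t => ∑ l, Real.exp (a l + t * s l))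
      (∑ l, Real.exp (a l + t * s l) * s l) t := fun t =>
    HasDerivAt.fun_sum fun l _ => hexp l t
  have hW : ∀ t : ℝ, HasDerivAt (fun t => ∑ l, Real.exp (a l + t * s l) * s l)
      (∑ l, Real.exp (a l + t * s l) * s l * s l) t := fun t =>
    HasDerivAt.fun_sum fun l _ => (hexp l t).mul_const (s l)
  have h1 : (deriv fun t : ℝ => Real.log (∑ l, Real.exp (a l + t * s l)) - u * t) =
      fun t => (∑ l, Real.exp (a l + t * s l) * s l) / (∑ l, Real.exp (a l + t * s l)) - u := by
    funext t
    have := ((hZ t).log (hpos t).ne').fun_sub ((hasDerivAt_id t).const_mul u)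
    simpa using this.deriv
  rw [h1, (((hW 0).fun_div (hZ 0) (hpos 0).ne').sub_const u).deriv]
  refine div_nonneg ?_ (sq_nonneg _)
  have hcs := Finset.sum_mul_sq_le_sq_mul_sq Finset.univ
    (fun l => √(Real.exp (a l + 0 * s l))) fun l => √(Real.exp (a l + 0 * s l)) * s l
  have e : ∀ l, √(Real.exp (a l + 0 * s l)) * √(Real.exp (a l + 0 * s l)) =
      Real.exp (a l + 0 * s l) := fun l => Real.mul_self_sqrt (Real.exp_pos _).le
  have e1 : ∀ l, √(Real.exp (a l + 0 * s l)) * (√(Real.exp (a l + 0 * s l)) * s l) =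
      Real.exp (a l + 0 * s l) * s l := fun l => by rw [← mul_assoc, e]
  have e2 : ∀ l, √(Real.exp (a l + 0 * s l)) ^ 2 = Real.exp (a l + 0 * s l) := fun l => by
    rw [sq, e]
  have e3 : ∀ l, (√(Real.exp (a l + 0 * s l)) * s l) ^ 2 =
      Real.exp (a l + 0 * s l) * s l * s l := fun l => by rw [mul_pow, e2]; ring
  simp only [e1, e2, e3] at hcs
  linarith

lemma iteratedFDeriv_two_diag {E : Type*} [NormedAddCommGroup E] [NormedSpace ℝ E] {f : E → ℝ}
    (hf : ContDiff ℝ 2 f) (θ v : E) :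
    iteratedFDeriv ℝ 2 f θ ![v, v] = deriv (deriv fun t : ℝ => f (θ + t • v)) 0 := by
  have hline : ∀ t : ℝ, HasDerivAt (fun t : ℝ => θ + t • v) v t := fun t => by
    simpa using ((hasDerivAt_id t).smul_const v).const_add θ
  have hd : Differentiable ℝ f := hf.differentiable (by norm_num)
  have hd2 : Differentiable ℝ (fderiv ℝ f) :=
    (hf.fderiv_right (m := 1) (by norm_num)).differentiable (by norm_num)
  have h1 : (deriv fun t : ℝ => f (θ + t • v)) = fun t : ℝ => fderiv ℝ f (θ + t • v) v := by
    funext t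
    exact ((hd _).hasFDerivAt.comp_hasDerivAt t (hline t)).deriv
  have h2 : HasDerivAt (fun t : ℝ => fderiv ℝ f (θ + t • v)) (fderiv ℝ (fderiv ℝ f)
      (θ + (0 : ℝ) • v) v) 0 :=
    (hd2 _).hasFDerivAt.comp_hasDerivAt (0 : ℝ) (hline 0)
  have h3 := (h2.clm_apply (hasDerivAt_const (0 : ℝ) v)).deriv
  rw [h1, h3, iteratedFDeriv_two_apply]
  simp

lemma dotProduct_hessian_mulVec (f : Param d c → ℝ) (θ : Param d c) (v : ParamIdx d c → ℝ) :
    v ⬝ᵥ (hessian f θ *ᵥ v) =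
      iteratedFDeriv ℝ 2 f θ ![WithLp.toLp 2 v, WithLp.toLp 2 v] := by
  have hv : (WithLp.toLp 2 v : Param d c) =
      ∑ a, v a • EuclideanSpace.single a (1 : ℝ) := by
    ext a
    simp [Pi.single_apply]
  rw [iteratedFDeriv_two_apply]
  simp only [hessian, iteratedFDeriv_two_apply, dotProduct, Matrix.mulVec, Matrix.of_apply,
    Matrix.cons_val_zero, Matrix.cons_val_one]
  rw [hv]
  simp only [map_sum, map_smul, sum_apply, smul_apply,
    smul_eq_mul]
  simp only [Finset.mul_sum]
  rw [Finset.sum_comm]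
  exact Finset.sum_congr rfl fun a _ => Finset.sum_congr rfl fun a' _ => by ring

lemma posSemidef_hessian_nll [NeZero c] (x : Feature d) (y : Fin c) (θ : Param d c) :
    (hessian (nll x y) θ).PosSemidef := by
  refine .of_dotProduct_mulVec_nonneg ?_ fun v => ?_
  · ext a a'
    have h := (contDiff_nll x y).contDiffAt (x := θ) |>.isSymmSndFDerivAt (by simp)
    simp only [hessian, Matrix.conjTranspose_apply, Matrix.of_apply, star_trivial,
      iteratedFDeriv_two_apply]
    exact h _ _
  · rw [star_trivial, dotProduct_hessian_mulVec, iteratedFDeriv_two_diag (contDiff_nll x y), nll_eq]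
    set w : Param d c := WithLp.toLp 2 v
    have h := deriv_deriv_log_sum_exp_nonneg (fun l => logitCLM x l θ) (fun l => logitCLM x l w)
      (logitCLM x y w)
    -- An additive constant does not change the derivative.
    have e : (deriv fun t : ℝ => Real.log (∑ l, Real.exp (logitCLM x l (θ + t • w)))
        - logitCLM x y (θ + t • w)) = deriv fun t : ℝ =>
        Real.log (∑ l, Real.exp (logitCLM x l θ + t * logitCLM x l w)) - logitCLM x y w * t := by
      have : (fun t : ℝ => Real.log (∑ l, Real.exp (logitCLM x l (θ + t • w)))
          - logitCLM x y (θ + t • w)) = fun t : ℝ =>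
          (Real.log (∑ l, Real.exp (logitCLM x l θ + t * logitCLM x l w)) - logitCLM x y w * t)
            - logitCLM x y θ := by
        funext t
        simp only [map_add, map_smul, smul_eq_mul]
        ring
      rw [this]
      funext t
      rw [deriv_sub_const]
    rw [e]
    exact h

lemma posSemidef_fisher [NeZero c] (x : Feature d) (θ : Param d c) : (fisher x θ).PosSemidef :=
  Matrix.posSemidef_sum _ fun y _ => (posSemidef_hessian_nll x y θ).smul
    (div_nonneg (Real.exp_pos _).le (Finset.sum_nonneg fun _ _ => (Real.exp_pos _).le))

lemma posSemidef_meanFisher [NeZero c] {μ : Measure (Feature d)} {θ : Param d c}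
    (hμ : ∀ a a', Integrable (fun x => fisher x θ a a') μ) : (meanFisher μ θ).PosSemidef := by
  refine .of_dotProduct_mulVec_nonneg ?_ fun v => ?_
  · ext a a'
    simp only [meanFisher, Matrix.conjTranspose_apply, Matrix.of_apply, star_trivial]
    refine integral_congr_ae (.of_forall fun x => ?_)
    simpa using (posSemidef_fisher x θ).isHermitian.apply a a'
  · have : star v ⬝ᵥ (meanFisher μ θ *ᵥ v) = ∫ x, v ⬝ᵥ (fisher x θ *ᵥ v) ∂μ := by
      simp only [star_trivial, dotProduct, Matrix.mulVec, meanFisher, Matrix.of_apply]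
      rw [integral_finsetSum _ fun a _ => (integrable_finsetSum _ fun a' _ =>
        (hμ a a').mul_const _).const_mul _]
      refine Finset.sum_congr rfl fun a _ => ?_
      rw [integral_const_mul, integral_finsetSum _ fun a' _ => (hμ a a').mul_const _]
      simp only [integral_mul_const]
    rw [this]
    exact integral_nonneg fun x => by
      simpa using (posSemidef_fisher x θ).dotProduct_mulVec_nonneg v

lemma integral_multiset_sum_dirac (s : Multiset (Feature d)) (f : Feature d → ℝ) :
    Integrable f (s.map Measure.dirac).sum ∧
      ∫ x, f x ∂(s.map Measure.dirac).sum = (s.map f).sum := by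
  induction s using Multiset.induction_on with
  | empty => simp
  | cons a s ih =>
    have ha : Integrable f (Measure.dirac a) := integrable_dirac (by simp)
    simp only [Multiset.map_cons, Multiset.sum_cons]
    exact ⟨ha.add_measure ih.1, by rw [integral_add_measure ha ih.1, integral_dirac, ih.2]⟩

lemma meanFisher_empirical (s : Multiset (Feature d)) (θ : Param d c) :
    meanFisher (empirical s) θ =
      (Multiset.card s : ℝ)⁻¹ • (s.map fun x => fisher x θ).sum := by
  ext a a'
  have : ((s.map fun x => fisher x θ).sum) a a' = (s.map fun x => fisher x θ a a').sum := by
    induction s using Multiset.induction_on with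
    | empty => simp
    | cons b s ih => simp [ih]
  rw [Matrix.smul_apply, this]
  simp only [meanFisher, empirical, Matrix.of_apply]
  rw [integral_smul_measure, (integral_multiset_sum_dirac s _).2]
  simp

lemma sum_count_smul {G : Type*} [AddCommGroup G] [Module ℝ G] (g : Fin m → G)
    (S : Multiset (Fin m)) : ∑ j, (S.count j : ℝ) • g j = (S.map g).sum := by
  induction S using Multiset.induction_on with
  | empty => simp
  | cons a S ih =>
    simp only [Multiset.count_cons, Nat.cast_add, Nat.cast_ite, Nat.cast_one, Nat.cast_zero,
      add_smul, Finset.sum_add_distrib, ih, Multiset.map_cons, Multiset.sum_cons, ite_smul,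
      one_smul, zero_smul, Finset.sum_ite_eq', Finset.mem_univ, if_true]
    abel

/-- The Fisher information of `X₀` together with a selection of size `b` is a multiple of the
relaxed matrix at the multiplicities of the selection. -/
lemma meanFisher_labelled (θ : Param d c) (X₀ : Multiset (Feature d)) (x : Fin m → Feature d)
    {b : ℕ} (hb : 0 < b) {S : Multiset (Fin m)} (hS : Multiset.card S = b) :
    meanFisher (labelled X₀ x S) θ = ((Multiset.card X₀ + b : ℕ) : ℝ)⁻¹ •
      weightedMatrix θ X₀ x b fun j => (S.count j : ℝ) := by
  have hb' : (b : ℝ) ≠ 0 := by exact_mod_cast hb.ne'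
  rw [labelled, meanFisher_empirical, Multiset.card_add, Multiset.card_map, hS]
  congr 1
  simp only [weightedMatrix, poolMatrix, smul_add, Finset.sum_add_distrib, Multiset.map_add,
    Multiset.sum_add, Multiset.map_map, Function.comp_def]
  rw [← Finset.sum_smul, ← Nat.cast_sum, Multiset.sum_count_eq_card fun a _ => Finset.mem_univ a,
    hS, smul_smul, mul_one_div_cancel hb', one_smul,
    sum_count_smul (fun j => fisher (x j) θ), add_comm]

end FisherMatrix


/-! ### Whitening and the information ratio -/

section Whitening


variable {d c m : ℕ}

open scoped MatrixOrder in
lemma posSemidef_invSqrt (A : Matrix (ParamIdx d c) (ParamIdx d c) ℝ) :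
    (invSqrt A).PosSemidef :=
  Matrix.nonneg_iff_posSemidef.mp (CFC.sqrt_nonneg _)

open scoped MatrixOrder in
lemma invSqrt_mul_invSqrt {A : Matrix (ParamIdx d c) (ParamIdx d c) ℝ} (hA : A.PosDef) :
    invSqrt A * invSqrt A = A⁻¹ :=
  CFC.sqrt_mul_sqrt_self _ (Matrix.nonneg_iff_posSemidef.mpr hA.inv.posSemidef)

lemma fir_smul {k : ℝ} (hk : k ≠ 0) {A : Matrix (ParamIdx d c) (ParamIdx d c) ℝ}
    (hA : A.PosDef) (B : Matrix (ParamIdx d c) (ParamIdx d c) ℝ) :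
    fir (k • A) B = k⁻¹ * fir A B := by
  have hd : IsUnit A.det := (Matrix.isUnit_iff_isUnit_det A).mp hA.isUnit
  have : (k • A)⁻¹ = k⁻¹ • A⁻¹ := by
    apply Matrix.inv_eq_left_inv
    rw [smul_mul_smul_comm, inv_mul_cancel₀ hk, Matrix.nonsing_inv_mul _ hd, one_smul]
  rw [fir, fir, this, smul_mul_assoc, Matrix.trace_smul, smul_eq_mul]

/-- A spectral lower bound `τ` on `T` after whitening by `Σ` turns into a comparison of the
information ratios of `T` and `Σ`. -/
lemma posDef_and_fir_le_of_whitened {A T H : Matrix (ParamIdx d c) (ParamIdx d c) ℝ} {τ : ℝ}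
    (hτ : 0 < τ) (hA : A.PosDef) (hH : H.PosSemidef)
    (h : (invSqrt A * T * invSqrt A -
      τ • (1 : Matrix (ParamIdx d c) (ParamIdx d c) ℝ)).PosSemidef) :
    T.PosDef ∧ τ * fir T H ≤ fir A H := by
  set W := invSqrt A with hW
  have hWW : W * W = A⁻¹ := invSqrt_mul_invSqrt hA
  have hWh : W.IsHermitian := (posSemidef_invSqrt A).isHermitian
  have hWu : IsUnit W := by
    have : IsUnit (W * W) := hWW ▸ hA.inv.isUnit
    rw [Matrix.isUnit_iff_isUnit_det, Matrix.det_mul] at this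
    exact (Matrix.isUnit_iff_isUnit_det W).mpr (isUnit_of_mul_isUnit_left this)
  have hWd : IsUnit W.det := (Matrix.isUnit_iff_isUnit_det W).mp hWu
  have hS : (W * T * W).PosDef := by
    have := (Matrix.PosDef.one.smul hτ).add_posSemidef h
    rwa [add_sub_cancel] at this
  have hT : T.PosDef := by
    have hs : star W = W := hWh
    have := Matrix.IsUnit.posDef_star_left_conjugate_iff (x := T) hWu
    rw [hs] at this
    exact this.mp hS
  refine ⟨hT, ?_⟩
  have hTd : IsUnit T.det := (Matrix.isUnit_iff_isUnit_det T).mp hT.isUnit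
  have hcmp := smul_trace_inv_mul_le hτ.le hS h (posSemidef_conj_of_isHermitian hH hWh)
  have e1 : (W * H * W).trace = fir A H := by
    rw [fir, ← hWW, Matrix.trace_mul_comm, ← mul_assoc]
  have e2 : ((W * T * W)⁻¹ * (W * H * W)).trace = fir T H := by
    rw [fir, Matrix.mul_inv_rev, Matrix.mul_inv_rev, Matrix.trace_mul_comm]
    have : W * H * W * (W⁻¹ * (T⁻¹ * W⁻¹)) = W * (H * T⁻¹ * W⁻¹) := by
      simp only [mul_assoc]
      rw [← mul_assoc W W⁻¹, Matrix.mul_nonsing_inv _ hWd, one_mul]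
    rw [this, Matrix.trace_mul_comm, Matrix.nonsing_inv_mul_cancel_right _ _ hWd,
      Matrix.trace_mul_comm]
  rwa [e1, e2] at hcmp

lemma invSqrt_mul_mul_invSqrt {A : Matrix (ParamIdx d c) (ParamIdx d c) ℝ} (hA : A.PosDef) :
    invSqrt A * A * invSqrt A = 1 := by
  have hd : IsUnit A.det := (Matrix.isUnit_iff_isUnit_det A).mp hA.isUnit
  have h1 : invSqrt A * (invSqrt A * A) = 1 := by
    rw [← mul_assoc, invSqrt_mul_invSqrt hA, Matrix.nonsing_inv_mul _ hd]
  exact mul_eq_one_comm.mp h1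

lemma posSemidef_poolMatrix [NeZero c] (θ : Param d c) (X₀ : Multiset (Feature d))
    (x : Fin m → Feature d) (b : ℕ) (j : Fin m) : (poolMatrix θ X₀ x b j).PosSemidef := by
  refine (posSemidef_fisher _ _).add (.smul ?_ (by positivity))
  induction X₀ using Multiset.induction_on with
  | empty => simpa using Matrix.PosSemidef.zero
  | cons a s ih => simpa using (posSemidef_fisher a θ).add ih

lemma card_selected {b : ℕ} (i : Fin b → Fin m) : Multiset.card (selected i) = b := by
  simp [selected]

lemma weightedMatrix_count_selected (θ : Param d c) (X₀ : Multiset (Feature d))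
    (x : Fin m → Feature d) {b : ℕ} (i : Fin b → Fin m) :
    weightedMatrix θ X₀ x b (fun j => ((selected i).count j : ℝ)) =
      ∑ t, poolMatrix θ X₀ x b (i t) := by
  rw [weightedMatrix, sum_count_smul, selected, Multiset.map_map]
  rfl

end Whitening

end FisherSelection

/-! ### Near-optimality of the rounded selection -/

open FisherSelection in
theorem mainTheorem5 {d c m : ℕ} (hd : 1 ≤ d) (hc : 2 ≤ c)
    (p : Measure (FisherSelection.Feature d)) [IsProbabilityMeasure p]
    (θ₀ : FisherSelection.Param d c)
    (hp : ∀ a a', Integrable (fun x => FisherSelection.fisher x θ₀ a a') p)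
    (X₀ : Multiset (FisherSelection.Feature d)) (x : Fin m → FisherSelection.Feature d)
    (ε η : ℝ) (hε₀ : 0 < ε) (hε₁ : ε < 1)
    (hη : η = 8 * Real.sqrt ((d * (c - 1) : ℕ) : ℝ) / ε)
    (b : ℕ)
    (hb : 32 * ((d * (c - 1) : ℕ) : ℝ) / ε ^ 2 + 16 * Real.sqrt ((d * (c - 1) : ℕ) : ℝ) / ε ^ 2
      ≤ (b : ℝ))
    (z : Fin m → ℝ) (hz : FisherSelection.IsRelaxedOptimum p θ₀ X₀ x b z)
    (i : Fin b → Fin m)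
    (hi : FisherSelection.IsRoundRun (FisherSelection.whitened θ₀ X₀ x b z) η b i) :
    (FisherSelection.meanFisher
        (FisherSelection.labelled X₀ x (FisherSelection.selected i)) θ₀).PosDef ∧
      (∀ S, FisherSelection.IsOptimalSelection p θ₀ X₀ x
          (FisherSelection.subsetsOfSize m b) S →
        FisherSelection.fir
            (FisherSelection.meanFisher
              (FisherSelection.labelled X₀ x (FisherSelection.selected i)) θ₀)
            (FisherSelection.meanFisher p θ₀) ≤
          (1 + ε) * FisherSelection.fir
            (FisherSelection.meanFisher (FisherSelection.labelled X₀ x S) θ₀)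
            (FisherSelection.meanFisher p θ₀)) ∧
      (∀ S, FisherSelection.IsOptimalSelection p θ₀ X₀ x
          (FisherSelection.multisetsOfSize m b) S →
        FisherSelection.fir
            (FisherSelection.meanFisher
              (FisherSelection.labelled X₀ x (FisherSelection.selected i)) θ₀)
            (FisherSelection.meanFisher p θ₀) ≤
          (1 + ε) * FisherSelection.fir
            (FisherSelection.meanFisher (FisherSelection.labelled X₀ x S) θ₀)
            (FisherSelection.meanFisher p θ₀)) := by
  have : NeZero c := ⟨by omega⟩
  obtain ⟨⟨hz0, hzb, hzA⟩, hzmin⟩ := hz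
  set A := weightedMatrix θ₀ X₀ x b z with hAdef
  set H := meanFisher p θ₀
  have hH : H.PosSemidef := posSemidef_meanFisher hp
  have : Nonempty (ParamIdx d c) := ⟨(⟨0, by omega⟩, ⟨0, by omega⟩)⟩
  have hcard : Fintype.card (ParamIdx d c) = d * (c - 1) := by
    simp [ParamIdx, mul_comm]
  rw [← hcard] at hη hb
  have hD : (0 : ℝ) < Fintype.card (ParamIdx d c) := by exact_mod_cast Fintype.card_pos
  set r := √(Fintype.card (ParamIdx d c) : ℝ) with hr
  have hr0 : 0 < r := Real.sqrt_pos.mpr hD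
  have hrr : r ^ 2 = Fintype.card (ParamIdx d c) := Real.sq_sqrt hD.le
  have hη0 : 0 < η := hη ▸ by positivity
  have hb' : 32 * r ^ 2 / ε ^ 2 ≤ b := by
    rw [hrr]
    have : 0 ≤ 16 * r / ε ^ 2 := by positivity
    linarith
  have hbpos : 0 < b := by
    have : (0 : ℝ) < b := lt_of_lt_of_le (by positivity) hb'
    exact_mod_cast this
  set F := whitened θ₀ X₀ x b z with hFdef
  have hW : (invSqrt A).IsHermitian := (posSemidef_invSqrt A).isHermitian
  have hF : ∀ j, (F j).PosSemidef := fun j =>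
    posSemidef_conj_of_isHermitian (posSemidef_poolMatrix θ₀ X₀ x b j) hW
  have hzF : ∑ j, z j • F j = 1 := by
    rw [← invSqrt_mul_mul_invSqrt hzA]
    conv_rhs => enter [1, 2]; rw [hAdef, weightedMatrix]
    simp only [Finset.mul_sum, Finset.sum_mul, mul_smul_comm, smul_mul_assoc]
    rfl
  obtain ⟨M, hMν, hM, hM1, hmax⟩ := hi
  choose ν hMν using hMν
  have hspec := posSemidef_sum_sub_smul_one hF hz0 hzb hzF hη0 hbpos hMν hM hM1 hmax
  have hnum := one_le_one_add_mul_of_budget hr0 hε₀ hε₁ hη hb'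
  set τ := (2 - 2 * r) / η + b / (b + η * r)
  have hτ : 0 < τ := by
    by_contra hneg
    nlinarith
  have hsum : ∑ t, F (i t) =
      invSqrt A * (∑ t, poolMatrix θ₀ X₀ x b (i t)) * invSqrt A := by
    simp only [Finset.mul_sum, Finset.sum_mul]
    rfl
  rw [hsum, ← weightedMatrix_count_selected] at hspec
  obtain ⟨hT, hTfir⟩ := posDef_and_fir_le_of_whitened hτ hzA hH hspec
  have hk : (0 : ℝ) < ((Multiset.card X₀ + b : ℕ) : ℝ)⁻¹ := by
    have : 0 < Multiset.card X₀ + b := by omega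
    positivity
  have hq := meanFisher_labelled θ₀ X₀ x hbpos (card_selected i)
  set k := ((Multiset.card X₀ + b : ℕ) : ℝ)⁻¹
  have hmain : ∀ S : Multiset (Fin m), Multiset.card S = b →
      (meanFisher (labelled X₀ x S) θ₀).PosDef →
      fir (meanFisher (labelled X₀ x (selected i)) θ₀) H ≤
        (1 + ε) * fir (meanFisher (labelled X₀ x S) θ₀) H := by
    intro S hS hpos
    have hSq := meanFisher_labelled θ₀ X₀ x hbpos hS
    have hSA : (weightedMatrix θ₀ X₀ x b fun j => (S.count j : ℝ)).PosDef := by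
      have := hpos.smul (inv_pos.mpr hk)
      rwa [hSq, smul_smul, inv_mul_cancel₀ hk.ne', one_smul] at this
    -- The multiplicities of a selection are feasible for the relaxed problem.
    have hle := hzmin (fun j => (S.count j : ℝ)) ⟨fun j => Nat.cast_nonneg _, by
      rw [← Nat.cast_sum, Multiset.sum_count_eq_card fun a _ => Finset.mem_univ a, hS], hSA⟩
    rw [hq, hSq, fir_smul hk.ne' hT, fir_smul hk.ne' hSA, mul_left_comm]
    refine mul_le_mul_of_nonneg_left ?_ (inv_nonneg.mpr hk.le)
    have hT0 : 0 ≤ fir (weightedMatrix θ₀ X₀ x b fun j => ((selected i).count j : ℝ)) H :=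
      trace_mul_nonneg_of_posSemidef hT.inv.posSemidef hH
    have h1 := mul_le_mul_of_nonneg_right hnum hT0
    have h2 : (0 : ℝ) ≤ 1 + ε := by linarith
    have h3 := mul_le_mul_of_nonneg_left (hTfir.trans hle) h2
    linarith
  refine ⟨?_, fun S hS => hmain S hS.1.1 hS.2.1, fun S hS => hmain S hS.1 hS.2.1⟩
  rw [hq]
  exact hT.smul hk
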